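/- For a finite group $G$ put $\sigma_1(G)=\frac{1}{|G|}\sum_{H\leq G}|H|$, where the sum runs over all subgroups $H$ of $G$. Then, up to isomorphism, $\mathbb{Z}_2\times\mathbb{Z}_4$ is the unique finite non-cyclic nilpotent group $G$ satisfying $\sigma_1(G)=2+\frac{11}{|G|}$, and $A_4$ (the alternating group of degree $4$) is the unique finite non-nilpotent group $G$ satisfying $\sigma_1(G)=2+\frac{11}{|G|}$. -/

import Mathlib

/-- The normalised sum of the orders of all subgroups of a finite group `G`,
`σ₁(G) = (1 / |G|) * ∑_{H ≤ G} |H|`. The sum has finitely many terms, since `G` is finite. -/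
noncomputable def sigmaOne (G : Type*) [Group G] [Finite G] : ℚ :=
  (1 / (Nat.card G : ℚ)) * ∑ᶠ H : Subgroup G, (Nat.card H : ℚ)

/-- The sum of the orders of all subgroups of `G`. -/
noncomputable def subgroupOrderSum (G : Type*) [Group G] : ℕ :=
  ∑ᶠ H : Subgroup G, Nat.card H

/-- The number of subgroups of `G` of order `d`. -/
noncomputable def numSubgroups (G : Type*) [Group G] (d : ℕ) : ℕ :=
  Nat.card {H : Subgroup G // Nat.card H = d}

theorem sigmaOne_eq_iff (G : Type*) [Group G] [Finite G] :
    sigmaOne G = 2 + 11 / (Nat.card G : ℚ) ↔ subgroupOrderSum G = 2 * Nat.card G + 11 := by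
  have hn : (Nat.card G : ℚ) ≠ 0 := by exact_mod_cast Nat.card_pos.ne'
  have : (∑ᶠ H : Subgroup G, (Nat.card H : ℚ)) = (subgroupOrderSum G : ℚ) := by
    have := Fintype.ofFinite (Subgroup G)
    simp [subgroupOrderSum, finsum_eq_sum_of_fintype]
  rw [sigmaOne, this, ← @Nat.cast_inj ℚ]
  push_cast
  constructor <;> intro h
  · field_simp at h; linarith
  · field_simp; linarith

theorem subgroupOrderSum_congr {G H : Type*} [Group G] [Group H] (e : G ≃* H) :
    subgroupOrderSum G = subgroupOrderSum H := by
  unfold subgroupOrderSum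
  refine finsum_eq_of_bijective (MulEquiv.mapSubgroup e) (Equiv.bijective _) fun K => ?_
  exact Nat.card_congr (e.subgroupMap K).toEquiv

theorem sum_card_le_subgroupOrderSum {G : Type*} [Group G] [Finite G] (T : Finset (Subgroup G)) :
    ∑ H ∈ T, Nat.card H ≤ subgroupOrderSum G := by
  have := Fintype.ofFinite (Subgroup G)
  rw [subgroupOrderSum, finsum_eq_sum_of_fintype]
  exact Finset.sum_le_sum_of_subset (Finset.subset_univ T)

theorem subgroupOrderSum_eq_sum_divisors (G : Type*) [Group G] [Finite G] :
    subgroupOrderSum G = ∑ d ∈ (Nat.card G).divisors, d * numSubgroups G d := by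
  classical
  have := Fintype.ofFinite (Subgroup G)
  rw [subgroupOrderSum, finsum_eq_sum_of_fintype,
    ← Finset.sum_fiberwise_of_maps_to (s := Finset.univ) (t := (Nat.card G).divisors)
      (g := fun H : Subgroup G => Nat.card H)
      (fun H _ => Nat.mem_divisors.2 ⟨H.card_subgroup_dvd_card, Nat.card_pos.ne'⟩)]
  refine Finset.sum_congr rfl fun d _ => ?_
  rw [Finset.sum_congr rfl (g := fun _ => d) (fun H hH => (Finset.mem_filter.1 hH).2),
    Finset.sum_const, smul_eq_mul, mul_comm, numSubgroups, Nat.card_eq_fintype_card,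
    Fintype.card_subtype]

theorem sum_mul_numSubgroups_le (G : Type*) [Group G] [Finite G] (D : Finset ℕ)
    (hD : ∀ d ∈ D, d ∣ Nat.card G) :
    ∑ d ∈ D, d * numSubgroups G d ≤ subgroupOrderSum G := by
  rw [subgroupOrderSum_eq_sum_divisors]
  exact Finset.sum_le_sum_of_subset fun d hd => Nat.mem_divisors.2 ⟨hD d hd, Nat.card_pos.ne'⟩

theorem numSubgroups_pos {G : Type*} [Group G] [Finite G] (H : Subgroup G) :
    0 < numSubgroups G (Nat.card H) :=
  have : Nonempty {K : Subgroup G // Nat.card K = Nat.card H} := ⟨⟨H, rfl⟩⟩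
  Nat.card_pos

theorem numSubgroups_eq_one {G : Type*} [Group G] (H : Subgroup G)
    (h : ∀ K : Subgroup G, Nat.card K = Nat.card H → K = H) :
    numSubgroups G (Nat.card H) = 1 :=
  Nat.card_eq_one_iff_unique.2
    ⟨⟨fun a b => Subtype.ext ((h _ a.2).trans (h _ b.2).symm)⟩, ⟨⟨H, rfl⟩⟩⟩

theorem numSubgroups_one (G : Type*) [Group G] [Finite G] : numSubgroups G 1 = 1 := by
  have := numSubgroups_eq_one (⊥ : Subgroup G) fun K hK =>
    Subgroup.card_eq_one.1 (hK.trans Subgroup.card_bot)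
  rwa [Subgroup.card_bot] at this

theorem numSubgroups_card (G : Type*) [Group G] [Finite G] : numSubgroups G (Nat.card G) = 1 := by
  have := numSubgroups_eq_one (⊤ : Subgroup G) fun K hK =>
    (Subgroup.card_eq_iff_eq_top K).1 (hK.trans Subgroup.card_top)
  rwa [Subgroup.card_top] at this

/-- Subgroups of prime order `p` partition the elements of order `p`. -/
theorem numSubgroups_prime_mul (G : Type*) [Group G] [Finite G] {p : ℕ} (hp : p.Prime) :
    numSubgroups G p * (p - 1) = Nat.card {x : G // orderOf x = p} := by
  classical
  have := Fintype.ofFinite G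
  have := Fintype.ofFinite (Subgroup G)
  have key : ∀ H : {H : Subgroup G // Nat.card H = p},
      (Finset.univ.filter fun x : {x : G // orderOf x = p} =>
        (⟨Subgroup.zpowers x.1, (Nat.card_zpowers _).trans x.2⟩ :
          {H : Subgroup G // Nat.card H = p}) = H).card = p - 1 := by
    rintro ⟨H, hH⟩
    have e : (Finset.univ.filter fun x : G => x ∈ H).card = p := by
      rw [← hH, ← Fintype.card_subtype, Nat.card_eq_fintype_card]
    have e' := Finset.card_erase_of_mem (s := Finset.univ.filter fun x : G => x ∈ H) (a := 1)
      (by simp [H.one_mem])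
    rw [e] at e'
    refine Eq.trans ?_ e'
    refine Finset.card_bij (fun x _ => x.1) ?_ (fun a _ b _ h => Subtype.ext h) ?_
    · rintro ⟨x, hx⟩ h
      simp only [Finset.mem_filter, Finset.mem_univ, true_and, Subtype.mk.injEq] at h
      subst h
      simp only [Finset.mem_erase, Finset.mem_filter, Finset.mem_univ,
        Subgroup.mem_zpowers, and_true, ne_eq]
      rintro rfl
      rw [orderOf_one] at hx
      exact hp.one_lt.ne hx
    · intro x hx
      simp only [Finset.mem_erase, Finset.mem_filter, Finset.mem_univ, true_and, ne_eq] at hx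
      have ho : orderOf x = p := by
        have h1 : orderOf x ∣ p := hH ▸ Subgroup.orderOf_dvd_natCard H hx.2
        exact (hp.eq_one_or_self_of_dvd _ h1).resolve_left (by simpa using hx.1)
      refine ⟨⟨x, ho⟩, ?_, rfl⟩
      simp only [Finset.mem_filter, Finset.mem_univ, true_and, Subtype.mk.injEq]
      refine Subgroup.eq_of_le_of_card_ge (by simpa using hx.2) ?_
      rw [Nat.card_zpowers, ho, hH]
  have hc := Finset.card_eq_sum_card_fiberwise (s := Finset.univ) (t := Finset.univ)
    (f := fun x : {x : G // orderOf x = p} =>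
      (⟨Subgroup.zpowers x.1, (Nat.card_zpowers _).trans x.2⟩ :
        {H : Subgroup G // Nat.card H = p})) (by simp)
  rw [Finset.sum_congr rfl (fun H _ => key H), Finset.sum_const, smul_eq_mul] at hc
  rw [numSubgroups, Nat.card_eq_fintype_card, Nat.card_eq_fintype_card, ← Finset.card_univ,
    ← Finset.card_univ, hc]

/-- A maximal subgroup that is normal has prime index. -/
theorem IsCoatom.index_prime_of_normal {G : Type*} [Group G] [Finite G] {M : Subgroup G}
    (hM : IsCoatom M) [M.Normal] : M.index.Prime := by
  have h1 : M.index ≠ 1 := fun h => hM.1 (Subgroup.index_eq_one.1 h)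
  obtain ⟨p, hp, hd⟩ := Nat.exists_prime_and_dvd h1
  have := Fact.mk hp
  obtain ⟨x, hx⟩ := exists_prime_orderOf_dvd_card' (G := G ⧸ M) p hd
  have hle : M ≤ (Subgroup.zpowers x).comap (QuotientGroup.mk' M) := by
    intro g hg
    rw [Subgroup.mem_comap, QuotientGroup.mk'_apply, (QuotientGroup.eq_one_iff g).2 hg]
    exact one_mem _
  have hidx : (Subgroup.zpowers x).index * p = M.index := by
    rw [← hx, ← Nat.card_zpowers, Subgroup.index_mul_card]; rfl
  have hc := Subgroup.index_comap_of_surjective (Subgroup.zpowers x)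
    (QuotientGroup.mk'_surjective M)
  rcases hM.le_iff.1 hle with h | h
  · rw [h, Subgroup.index_top] at hc
    rw [← hidx, ← hc, one_mul]; exact hp
  · rw [h] at hc
    have : 0 < M.index := Nat.pos_of_ne_zero M.index_ne_zero_of_finite
    rw [← hc] at hidx
    have := hp.one_lt
    nlinarith

theorem Subgroup.exists_le_card_eq_prime_pow {G : Type*} [Group G] [Finite G] (N : Subgroup G)
    {p k : ℕ} (hp : p.Prime) (h : p ^ k ∣ Nat.card N) : ∃ H ≤ N, Nat.card H = p ^ k := by
  have := Fact.mk hp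
  obtain ⟨K, hK⟩ := Sylow.exists_subgroup_card_pow_prime p h
  refine ⟨K.map N.subtype, Subgroup.map_subtype_le _, ?_⟩
  rw [← hK]
  exact Nat.card_congr (K.equivMapOfInjective _ N.subtype_injective).symm.toEquiv

open Pointwise in
/-- The orbit of a maximal non-normal subgroup under conjugation has as many elements as its
index. -/
theorem IsCoatom.ncard_orbit_conjAct {G : Type*} [Group G] [Finite G] {M : Subgroup G}
    (hM : IsCoatom M) (hn : ¬ M.Normal) : (MulAction.orbit (ConjAct G) M).ncard = M.index := by
  let f : G →* ConjAct G := (ConjAct.toConjAct (G := G)).toMonoidHom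
  have hle : M.map f ≤ MulAction.stabilizer (ConjAct G) M := by
    rintro _ ⟨g, hg, rfl⟩
    exact Subgroup.conj_smul_eq_self_of_mem hg
  have hco : IsCoatom (M.map f) :=
    (OrderIso.isCoatom_iff (MulEquiv.mapSubgroup (ConjAct.toConjAct : G ≃* ConjAct G)) M).2 hM
  have hidx : (M.map f).index = M.index :=
    Subgroup.index_map_equiv M ConjAct.toConjAct
  rw [← MulAction.index_stabilizer]
  rcases hco.le_iff.1 hle with h | h
  · refine absurd ⟨fun m hm g => ?_⟩ hn
    have h1 : ConjAct.toConjAct g • M = M := by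
      rw [← MulAction.mem_stabilizer_iff, h]; trivial
    rw [← h1]
    exact ⟨m, hm, rfl⟩
  · rw [h, hidx]

open Pointwise in
theorem card_eq_of_mem_orbit_conjAct {G : Type*} [Group G] {M H : Subgroup G}
    (h : H ∈ MulAction.orbit (ConjAct G) M) : Nat.card H = Nat.card M := by
  obtain ⟨g, rfl⟩ := h
  exact Nat.card_congr (Subgroup.equivSMul g M).symm.toEquiv

open Pointwise in
theorem IsCoatom.not_mem_orbit_conjAct_of_le {G : Type*} [Group G] {M N H : Subgroup G}
    [N.Normal] (hM : IsCoatom M) (hn : ¬ M.Normal) (hN : N ≠ ⊤) (hH : H ≤ N) :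
    H ∉ MulAction.orbit (ConjAct G) M := by
  rintro ⟨g, rfl⟩
  have h1 : M ≤ N := by
    intro m hm
    have h2 : g • m ∈ N := hH (Subgroup.smul_mem_pointwise_smul m g M hm)
    rw [ConjAct.smul_def] at h2
    have := Subgroup.Normal.conj_mem ‹N.Normal› _ h2 (ConjAct.ofConjAct g)⁻¹
    simpa [mul_assoc] using this
  rcases hM.le_iff.1 h1 with h | h
  · exact hN h
  · exact hn (h ▸ ‹N.Normal›)

open Pointwise in
/-- The conjugates of a maximal non-normal subgroup contribute `|G|` to the sum of the orders. -/
theorem IsCoatom.sum_card_orbit_conjAct {G : Type*} [Group G] [Finite G] {M : Subgroup G}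
    (hM : IsCoatom M) (hn : ¬ M.Normal) :
    ∑ H ∈ (MulAction.orbit (ConjAct G) M).toFinite.toFinset, Nat.card H = Nat.card G := by
  rw [Finset.sum_congr rfl (g := fun _ => Nat.card M)
    (fun H hH => card_eq_of_mem_orbit_conjAct (by simpa using hH)), Finset.sum_const,
    ← Set.ncard_eq_toFinset_card, hM.ncard_orbit_conjAct hn, smul_eq_mul, M.index_mul_card]

open Pointwise in
theorem IsCoatom.sum_card_add_card_le {G : Type*} [Group G] [Finite G] {M : Subgroup G}
    (hM : IsCoatom M) (hn : ¬ M.Normal) (T : Finset (Subgroup G))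
    (hT : ∀ H ∈ T, H ∉ MulAction.orbit (ConjAct G) M) :
    ∑ H ∈ T, Nat.card H + Nat.card G ≤ subgroupOrderSum G := by
  classical
  have hdisj : Disjoint T (MulAction.orbit (ConjAct G) M).toFinite.toFinset :=
    Finset.disjoint_left.2 fun H hH hHC => hT H hH (by simpa using hHC)
  rw [← hM.sum_card_orbit_conjAct hn, ← Finset.sum_union hdisj]
  exact sum_card_le_subgroupOrderSum _

open Pointwise in
theorem IsCoatom.sum_add_card_le {G : Type*} [Group G] [Finite G] {M : Subgroup G}
    (hM : IsCoatom M) (hn : ¬ M.Normal) (D : Finset ℕ)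
    (hD : ∀ d ∈ D, ∃ H : Subgroup G, H ∉ MulAction.orbit (ConjAct G) M ∧ Nat.card H = d) :
    ∑ d ∈ D, d + Nat.card G ≤ subgroupOrderSum G := by
  classical
  choose! f hf using hD
  have hinj : Set.InjOn f D := fun a ha b hb h => by
    rw [← (hf a ha).2, ← (hf b hb).2, h]
  have := hM.sum_card_add_card_le hn (D.image f) fun H hH => by
    obtain ⟨d, hd, rfl⟩ := Finset.mem_image.1 hH
    exact (hf d hd).1
  rwa [Finset.sum_image hinj, Finset.sum_congr rfl fun d hd => (hf d hd).2] at this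

/-- A group of order `p ^ a * q ^ b` with normal subgroups of orders `p ^ a` and `q ^ b` is
nilpotent. -/
theorem isNilpotent_of_normal_of_normal {G : Type*} [Group G] [Finite G] {p q a b : ℕ}
    (hp : p.Prime) (hq : q.Prime) (hpq : p ≠ q) (hG : Nat.card G = p ^ a * q ^ b)
    (P Q : Subgroup G) [P.Normal] [Q.Normal] (hP : Nat.card P = p ^ a) (hQ : Nat.card Q = q ^ b) :
    Group.IsNilpotent G := by
  have := Fact.mk hp
  have := Fact.mk hq
  have hfp : (Nat.card G).factorization p = a := by
    rw [hG, Nat.factorization_mul (pow_pos hp.pos _).ne' (pow_pos hq.pos _).ne']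
    simp [hp.factorization, hq.factorization, hpq.symm]
  have hfq : (Nat.card G).factorization q = b := by
    rw [hG, Nat.factorization_mul (pow_pos hp.pos _).ne' (pow_pos hq.pos _).ne']
    simp [hp.factorization, hq.factorization, hpq]
  refine (Group.isNilpotent_of_finite_tfae.out 0 3 rfl rfl).2 fun r hr R => ?_
  by_cases hrp : r = p
  · subst hrp
    let S := Sylow.ofCard P (by rw [hP, hfp])
    have := Sylow.unique_of_normal S (by assumption)
    rw [Subsingleton.elim R S]; assumption
  by_cases hrq : r = q
  · subst hrq
    let S := Sylow.ofCard Q (by rw [hQ, hfq])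
    have := Sylow.unique_of_normal S (by assumption)
    rw [Subsingleton.elim R S]; assumption
  have hR : (R : Subgroup G) = ⊥ := by
    rw [← Subgroup.card_eq_one, Sylow.card_eq_multiplicity, hG,
      Nat.factorization_mul (pow_pos hp.pos _).ne' (pow_pos hq.pos _).ne']
    have h1 := hr.out
    simp [hp.factorization, hq.factorization, Ne.symm hrp, Ne.symm hrq]
  rw [hR]; infer_instance

theorem isNilpotent_of_card_prime_pow {G : Type*} [Group G] [Finite G] {p k : ℕ}
    (hp : p.Prime) (hG : Nat.card G = p ^ k) : Group.IsNilpotent G :=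
  have := Fact.mk hp
  (IsPGroup.of_card hG).isNilpotent

theorem numSubgroups_eq_card_sylow {G : Type*} [Group G] [Finite G] {p : ℕ} [Fact p.Prime] :
    numSubgroups G (p ^ (Nat.card G).factorization p) = Nat.card (Sylow p G) :=
  Nat.card_congr
    { toFun := fun H => Sylow.ofCard H.1 H.2
      invFun := fun P => ⟨P, P.card_eq_multiplicity⟩
      left_inv := fun _ => rfl
      right_inv := fun _ => rfl }

theorem card_sylow_eq_one_iff_normal {G : Type*} [Group G] [Finite G] {p : ℕ} [Fact p.Prime]
    (P : Sylow p G) : Nat.card (Sylow p G) = 1 ↔ (P : Subgroup G).Normal := by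
  constructor
  · intro h
    have := (Nat.card_eq_one_iff_unique.1 h).1
    exact P.normal_of_subsingleton
  · intro h
    have := Sylow.unique_of_normal P h
    exact Nat.card_unique

/-- A group of order `12` with a non-normal subgroup of order `3` is the alternating group on
four letters. -/
theorem nonempty_mulEquiv_alternatingGroup {G : Type*} [Group G] [Finite G]
    (hG : Nat.card G = 12) (P : Subgroup G) (hP : Nat.card P = 3) (hn : ¬ P.Normal) :
    Nonempty (G ≃* alternatingGroup (Fin 4)) := by
  have hidx : Nat.card (G ⧸ P) = 4 := by
    have := P.index_mul_card
    rw [hG, hP] at this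
    change P.index = 4
    omega
  have hcore : P.normalCore = ⊥ := by
    have h1 : Nat.card P.normalCore ∣ 3 := hP ▸ Subgroup.card_dvd_of_le P.normalCore_le
    rcases (Nat.dvd_prime Nat.prime_three).1 h1 with h | h
    · exact Subgroup.card_eq_one.1 h
    · have := Subgroup.eq_of_le_of_card_ge P.normalCore_le (by rw [h, hP])
      exact absurd (this ▸ P.normalCore_normal) hn
  have e : (G ⧸ P) ≃ Fin 4 := Finite.equivFinOfCardEq hidx
  let f : G →* Equiv.Perm (Fin 4) :=
    e.permCongrHom.toMonoidHom.comp (MulAction.toPermHom G (G ⧸ P))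
  have hf : Function.Injective f := by
    refine e.permCongrHom.injective.comp ?_
    rw [← MonoidHom.ker_eq_bot_iff, ← Subgroup.normalCore_eq_ker, hcore]
  have hr : f.range = alternatingGroup (Fin 4) := by
    apply Equiv.Perm.eq_alternatingGroup_of_index_eq_two
    have h1 := f.range.index_mul_card
    have h2 : Nat.card f.range = 12 := by
      rw [← hG]; exact Nat.card_congr (MonoidHom.ofInjective hf).symm.toEquiv
    rw [h2, Nat.card_perm, Nat.card_fin] at h1
    simp [Nat.factorial] at h1
    omega
  exact ⟨(MonoidHom.ofInjective hf).trans (MulEquiv.subgroupCongr hr)⟩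

open Pointwise in
theorem exists_isCoatom_not_mem_orbit_conjAct {G : Type*} [Group G] [Finite G]
    (hG : ¬ Group.IsNilpotent G) {M : Subgroup G} (hM : IsCoatom M) :
    ∃ K : Subgroup G, IsCoatom K ∧ K ∉ MulAction.orbit (ConjAct G) M := by
  have h1 : M.index ≠ 1 := fun h => hM.1 (Subgroup.index_eq_one.1 h)
  obtain ⟨p, hp, hd⟩ := Nat.exists_prime_and_dvd h1
  have := Fact.mk hp
  obtain ⟨P⟩ : Nonempty (Sylow p G) := inferInstance
  have hP : (P : Subgroup G) ≠ ⊤ := fun h => hG <| by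
    have h2 := P.isPGroup'
    rw [h] at h2
    exact (h2.of_equiv Subgroup.topEquiv).isNilpotent
  obtain ⟨K, hK, hPK⟩ := (eq_top_or_exists_le_coatom (P : Subgroup G)).resolve_left hP
  refine ⟨K, hK, fun hKM => P.not_dvd_index ?_⟩
  obtain ⟨k, hk⟩ := Subgroup.card_dvd_of_le hPK
  rw [card_eq_of_mem_orbit_conjAct hKM] at hk
  have h3 := M.card_mul_index
  rw [hk, ← (P : Subgroup G).card_mul_index, mul_assoc] at h3
  rw [← Nat.eq_of_mul_eq_mul_left Nat.card_pos h3]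
  exact hd.mul_left k

theorem exists_normal_index_prime_of_card_le_eleven {G : Type*} [Group G] [Finite G]
    (hG : ¬ Group.IsNilpotent G) (hn : Nat.card G ≤ 11) :
    ∃ N : Subgroup G, N.Normal ∧ N.index.Prime := by
  have hpp : ∀ p k : ℕ, p.Prime → Nat.card G ≠ p ^ k := fun p k hp h =>
    hG (isNilpotent_of_card_prime_pow hp h)
  have hhalf : ∀ q : ℕ, q.Prime → Nat.card G = 2 * q →
      ∃ N : Subgroup G, N.Normal ∧ N.index.Prime := by
    intro q hq h
    have := Fact.mk hq
    obtain ⟨N, hN⟩ := Sylow.exists_subgroup_card_pow_prime (G := G) q (n := 1)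
      (by rw [h, pow_one]; exact Dvd.intro_left 2 rfl)
    have h2 : N.index = 2 := by
      have := N.index_mul_card
      rw [hN, h, pow_one] at this
      exact Nat.eq_of_mul_eq_mul_right hq.pos this
    exact ⟨N, Subgroup.normal_of_index_eq_two h2, h2 ▸ Nat.prime_two⟩
  have h0 : 0 < Nat.card G := Nat.card_pos
  generalize hc : Nat.card G = n at *
  interval_cases n
  · exact absurd rfl (hpp 2 0 Nat.prime_two)
  · exact absurd rfl (hpp 2 1 Nat.prime_two)
  · exact absurd rfl (hpp 3 1 Nat.prime_three)
  · exact absurd rfl (hpp 2 2 Nat.prime_two)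
  · exact absurd rfl (hpp 5 1 Nat.prime_five)
  · exact hhalf 3 Nat.prime_three rfl
  · exact absurd rfl (hpp 7 1 (by norm_num))
  · exact absurd rfl (hpp 2 3 Nat.prime_two)
  · exact absurd rfl (hpp 3 2 Nat.prime_three)
  · exact hhalf 5 Nat.prime_five rfl
  · exact absurd rfl (hpp 11 1 (by norm_num))

open Pointwise in
theorem exists_normal_index_prime {G : Type*} [Group G] [Finite G]
    (hG : ¬ Group.IsNilpotent G) (hS : subgroupOrderSum G = 2 * Nat.card G + 11) :
    ∃ N : Subgroup G, N.Normal ∧ N.index.Prime := by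
  classical
  obtain ⟨M, hM, hMn⟩ : ∃ M : Subgroup G, IsCoatom M ∧ ¬ M.Normal := by
    by_contra! h
    exact hG ((Group.isNilpotent_of_finite_tfae.out 0 2 rfl rfl).2 h)
  obtain ⟨K, hK, hKM⟩ := exists_isCoatom_not_mem_orbit_conjAct hG hM
  by_cases hKn : K.Normal
  · exact ⟨K, hKn, hK.index_prime_of_normal⟩
  refine exists_normal_index_prime_of_card_le_eleven hG ?_
  set C := (MulAction.orbit (ConjAct G) K).toFinite.toFinset with hC
  have htop : ∀ L : Subgroup G, IsCoatom L → (⊤ : Subgroup G) ∉ MulAction.orbit (ConjAct G) L :=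
    fun L hL h => hL.1 ((Subgroup.card_eq_iff_eq_top L).1
      ((card_eq_of_mem_orbit_conjAct h).symm.trans Subgroup.card_top))
  have h := hM.sum_card_add_card_le hMn (insert ⊤ C) fun H hH => by
    rcases Finset.mem_insert.1 hH with rfl | hH
    · exact htop M hM
    · intro h
      refine hKM ?_
      rw [← MulAction.orbit_eq_iff] at h
      rw [← h]
      have h2 : H ∈ MulAction.orbit (ConjAct G) K := by simpa [hC] using hH
      rw [← MulAction.orbit_eq_iff] at h2
      rw [h2]
      exact MulAction.mem_orbit_self K
  rw [Finset.sum_insert (by simpa [hC] using htop K hK), hC, hK.sum_card_orbit_conjAct hKn,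
    Subgroup.card_top] at h
  omega

open Pointwise in
/-- The order of a normal subgroup of prime index is a prime or four. -/
theorem card_prime_or_eq_four {G : Type*} [Group G] [Finite G]
    (hG : ¬ Group.IsNilpotent G) (hS : subgroupOrderSum G = 2 * Nat.card G + 11)
    (N : Subgroup G) [N.Normal] (hN : N.index.Prime) :
    (Nat.card N).Prime ∨ Nat.card N = 4 := by
  obtain ⟨M, hM, hMn⟩ : ∃ M : Subgroup G, IsCoatom M ∧ ¬ M.Normal := by
    by_contra! h
    exact hG ((Group.isNilpotent_of_finite_tfae.out 0 2 rfl rfl).2 h)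
  have hNtop : N ≠ ⊤ := fun h => by
    rw [h, Subgroup.index_top] at hN; exact Nat.not_prime_one hN
  have hcard := N.index_mul_card
  have hlt : Nat.card N < Nat.card G := by
    have := hN.two_le
    have : 0 < Nat.card N := Nat.card_pos
    nlinarith
  have hone : Nat.card N ≠ 1 := fun h => hG <| isNilpotent_of_card_prime_pow (k := 1) hN <| by
    rw [← hcard, h]; simp
  have key : ∀ D : Finset ℕ, (∀ d ∈ D, ∃ H ≤ N, Nat.card H = d) → ∑ d ∈ D, d ≤ 11 := by
    intro D hD
    have hnot : Nat.card G ∉ D := fun h => by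
      obtain ⟨H, hHN, hH⟩ := hD _ h
      exact absurd (Subgroup.card_le_of_le hHN) (by omega)
    have htop : (⊤ : Subgroup G) ∉ MulAction.orbit (ConjAct G) M :=
      fun h => hM.1 ((Subgroup.card_eq_iff_eq_top M).1
        ((card_eq_of_mem_orbit_conjAct h).symm.trans Subgroup.card_top))
    have := hM.sum_add_card_le hMn (insert (Nat.card G) D) fun d hd => by
      rcases Finset.mem_insert.1 hd with rfl | hd
      · exact ⟨⊤, htop, Subgroup.card_top⟩
      · obtain ⟨H, hHN, hH⟩ := hD d hd
        exact ⟨H, hM.not_mem_orbit_conjAct_of_le hMn hNtop hHN, hH⟩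
    rw [Finset.sum_insert hnot] at this
    omega
  have hself : ∃ H ≤ N, Nat.card H = Nat.card N := ⟨N, le_rfl, rfl⟩
  have hbot : ∃ H ≤ N, Nat.card H = 1 := ⟨⊥, bot_le, Subgroup.card_bot⟩
  have hpow : ∀ p k : ℕ, p.Prime → p ^ k ∣ Nat.card N → ∃ H ≤ N, Nat.card H = p ^ k :=
    fun p k hp h => N.exists_le_card_eq_prime_pow hp h
  have h10 : Nat.card N ≤ 10 := by
    have := key {1, Nat.card N} (by
      simp only [Finset.mem_insert, Finset.mem_singleton]
      rintro d (rfl | rfl) <;> assumption)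
    rw [Finset.sum_pair hone.symm] at this
    omega
  have h0 : 0 < Nat.card N := Nat.card_pos
  generalize Nat.card N = m at *
  interval_cases m
  · exact absurd rfl hone
  · exact Or.inl (by norm_num)
  · exact Or.inl (by norm_num)
  · exact Or.inr rfl
  · exact Or.inl (by norm_num)
  · have h2 := hpow 2 1 Nat.prime_two (by norm_num)
    have h3 := hpow 3 1 Nat.prime_three (by norm_num)
    have := key {1, 2, 3, 6} (by
      simp only [Finset.mem_insert, Finset.mem_singleton]
      rintro d (rfl | rfl | rfl | rfl) <;> assumption)
    simp at this
  · exact Or.inl (by norm_num)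
  · have h2 := hpow 2 1 Nat.prime_two (by norm_num)
    have h3 := hpow 2 2 Nat.prime_two (by norm_num)
    have := key {1, 2, 4, 8} (by
      simp only [Finset.mem_insert, Finset.mem_singleton]
      rintro d (rfl | rfl | rfl | rfl) <;> assumption)
    simp at this
  · have h3 := hpow 3 1 Nat.prime_three (by norm_num)
    have := key {1, 3, 9} (by
      simp only [Finset.mem_insert, Finset.mem_singleton]
      rintro d (rfl | rfl | rfl) <;> assumption)
    simp at this
  · have h2 := hpow 2 1 Nat.prime_two (by norm_num)
    have := key {1, 2, 10} (by
      simp only [Finset.mem_insert, Finset.mem_singleton]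
      rintro d (rfl | rfl | rfl) <;> assumption)
    simp at this

theorem subgroupOrderSum_ne_of_card_eq_prime_mul_prime {G : Type*} [Group G] [Finite G]
    (hG : ¬ Group.IsNilpotent G) (N : Subgroup G) [N.Normal] {p q : ℕ} (hp : p.Prime)
    (hq : q.Prime) (hN : Nat.card N = q) (hcard : Nat.card G = p * q) :
    subgroupOrderSum G ≠ 2 * Nat.card G + 11 := by
  have := Fact.mk hp
  have := Fact.mk hq
  have hpq : p ≠ q := by
    rintro rfl
    exact hG (isNilpotent_of_card_prime_pow (k := 2) hp (by rw [hcard, sq]))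
  have hfp : (Nat.card G).factorization p = 1 := by
    rw [hcard, Nat.factorization_mul hp.ne_zero hq.ne_zero]
    simp [hp.factorization, hq.factorization, hpq.symm]
  have hfq : (Nat.card G).factorization q = 1 := by
    rw [hcard, Nat.factorization_mul hp.ne_zero hq.ne_zero]
    simp [hp.factorization, hq.factorization, hpq]
  have hcq : numSubgroups G q = 1 := by
    have h := numSubgroups_eq_card_sylow (G := G) (p := q)
    rw [hfq, pow_one] at h
    rw [h]
    exact (card_sylow_eq_one_iff_normal (Sylow.ofCard N (by rw [hN, hfq, pow_one]))).2
      (by simpa)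
  have hcp : numSubgroups G p = q := by
    have h := numSubgroups_eq_card_sylow (G := G) (p := p)
    rw [hfp, pow_one] at h
    rw [h]
    obtain ⟨P⟩ : Nonempty (Sylow p G) := inferInstance
    have hPc : Nat.card P = p := by rw [P.card_eq_multiplicity, hfp, pow_one]
    have hi : (P : Subgroup G).index = q := by
      have := (P : Subgroup G).card_mul_index
      rw [hPc, hcard] at this
      exact Nat.eq_of_mul_eq_mul_left hp.pos this
    refine ((Nat.dvd_prime hq).1 (hi ▸ P.card_dvd_index)).resolve_left fun h1 => hG ?_
    have := (card_sylow_eq_one_iff_normal P).1 h1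
    exact isNilpotent_of_normal_of_normal hp hq hpq (a := 1) (b := 1) (by simpa) P N
      (by simpa) (by simpa)
  have h1 : (1 : ℕ) ≠ p := hp.one_lt.ne
  have h2 : (1 : ℕ) ≠ q := hq.one_lt.ne
  have h3 : (1 : ℕ) ≠ p * q := by simp [hp.ne_one, eq_comm]
  have h4 : p ≠ p * q := by simp [hp.ne_zero, hq.ne_one]
  have h5 : q ≠ p * q := by simp [hq.ne_zero, hp.ne_one]
  have hdiv : (Nat.card G).divisors = {1, p, q, p * q} := by
    rw [hcard]
    ext d
    rw [Nat.mem_divisors]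
    simp only [Finset.mem_insert, Finset.mem_singleton]
    constructor
    · rintro ⟨hd, -⟩
      obtain ⟨a, b, ha, hb, rfl⟩ := (Nat.dvd_mul).1 hd
      rcases (Nat.dvd_prime hp).1 ha with rfl | rfl <;>
        rcases (Nat.dvd_prime hq).1 hb with rfl | rfl <;> simp
    · have : p * q ≠ 0 := mul_ne_zero hp.ne_zero hq.ne_zero
      rintro (rfl | rfl | rfl | rfl) <;> simp [this]
  have hn := numSubgroups_card G
  rw [subgroupOrderSum_eq_sum_divisors, hdiv, Finset.sum_insert (by simp [h1, h2, h3]),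
    Finset.sum_insert (by simp [hpq, h4]), Finset.sum_pair h5, numSubgroups_one, hcp, hcq,
    ← hcard, hn, hcard]
  intro h
  have : q = 10 := by omega
  rw [this] at hq
  norm_num at hq

/-- If `G` is not nilpotent, has order `4 * p` and a normal subgroup of order `4`, then `p = 3`. -/
theorem eq_three_of_normal_four {G : Type*} [Group G] [Finite G]
    (hG : ¬ Group.IsNilpotent G)
    (N : Subgroup G) [N.Normal] (hN : Nat.card N = 4) {p : ℕ} (hp : p.Prime)
    (hcard : Nat.card G = p * 4) : p = 3 := by
  have := Fact.mk hp
  have hp2 : p ≠ 2 := by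
    rintro rfl
    exact hG (isNilpotent_of_card_prime_pow (k := 3) hp (by rw [hcard]; norm_num))
  have hfp : (Nat.card G).factorization p = 1 := by
    rw [hcard, show 4 = 2 ^ 2 by norm_num, Nat.factorization_mul hp.ne_zero (by norm_num),
      Nat.prime_two.factorization_pow, hp.factorization]
    simp [hp2.symm]
  obtain ⟨P⟩ : Nonempty (Sylow p G) := inferInstance
  have hPc : Nat.card P = p := by rw [P.card_eq_multiplicity, hfp, pow_one]
  have hPn : Nat.card (Sylow p G) ≠ 1 := fun h1 => hG <| by
    have := (card_sylow_eq_one_iff_normal P).1 h1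
    exact isNilpotent_of_normal_of_normal hp Nat.prime_two hp2 (a := 1) (b := 2)
      (by rw [hcard]; norm_num) P N (by simpa) (by simpa)
  have hi : (P : Subgroup G).index = 4 := by
    have := (P : Subgroup G).card_mul_index
    rw [hPc, hcard] at this
    exact Nat.eq_of_mul_eq_mul_left hp.pos this
  have hdvd : Nat.card (Sylow p G) ∣ 4 := hi ▸ P.card_dvd_index
  have hmod := card_sylow_modEq_one p G
  have h4 : Nat.card (Sylow p G) = 2 ∨ Nat.card (Sylow p G) = 4 := by
    have := Nat.le_of_dvd (by norm_num) hdvd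
    generalize Nat.card (Sylow p G) = s at *
    interval_cases s <;> simp_all
  have hd : p ∣ Nat.card (Sylow p G) - 1 :=
    (Nat.modEq_iff_dvd' (by omega)).1 hmod.symm
  rcases h4 with h | h <;> rw [h] at hd
  · exact absurd (Nat.le_of_dvd (by norm_num) hd) (by have := hp.two_le; omega)
  · exact (Nat.prime_dvd_prime_iff_eq hp Nat.prime_three).1 hd

theorem nonempty_mulEquiv_alternatingGroup_of_subgroupOrderSum {G : Type*} [Group G] [Finite G]
    (hG : ¬ Group.IsNilpotent G) (hS : subgroupOrderSum G = 2 * Nat.card G + 11) :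
    Nonempty (G ≃* alternatingGroup (Fin 4)) := by
  obtain ⟨N, hNn, hN⟩ := exists_normal_index_prime hG hS
  have hcard := N.index_mul_card.symm
  rcases card_prime_or_eq_four hG hS N hN with hq | h4
  · exact absurd hS
      (subgroupOrderSum_ne_of_card_eq_prime_mul_prime hG N hN hq rfl hcard)
  · rw [h4] at hcard
    have h3 := eq_three_of_normal_four hG N h4 hN hcard
    rw [h3] at hcard
    obtain ⟨P, hP⟩ := Sylow.exists_subgroup_card_pow_prime (G := G) 3 (n := 1)
      (by rw [hcard]; norm_num)
    refine nonempty_mulEquiv_alternatingGroup hcard P hP fun hn => hG ?_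
    exact isNilpotent_of_normal_of_normal Nat.prime_three Nat.prime_two (by norm_num) (a := 1)
      (b := 2) (by rw [hcard]; norm_num) P N hP (by simpa)

theorem exists_isCoatom_ne_of_not_isCyclic {P : Type*} [Group P] [Finite P]
    (h : ¬ IsCyclic P) : ∃ A B : Subgroup P, IsCoatom A ∧ IsCoatom B ∧ A ≠ B := by
  have hz : ∀ x : P, ∃ M : Subgroup P, IsCoatom M ∧ x ∈ M := fun x => by
    obtain ⟨M, hM, hx⟩ := (eq_top_or_exists_le_coatom (Subgroup.zpowers x)).resolve_left
      fun ht => h ⟨x, (Subgroup.eq_top_iff' _).1 ht⟩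
    exact ⟨M, hM, hx (Subgroup.mem_zpowers x)⟩
  obtain ⟨A, hA, -⟩ := hz 1
  obtain ⟨x, hx⟩ : ∃ x, x ∉ A := by
    by_contra! hall
    exact hA.1 (eq_top_iff.2 fun x _ => hall x)
  obtain ⟨B, hB, hxB⟩ := hz x
  exact ⟨A, B, hA, hB, fun hAB => hx (hAB ▸ hxB)⟩

/-- A finite non-cyclic nilpotent group has two normal subgroups of the same prime index. -/
theorem exists_normal_index_eq_prime_ne {G : Type*} [Group G] [Finite G]
    (hc : ¬ IsCyclic G) (hG : Group.IsNilpotent G) :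
    ∃ (p : ℕ) (A B : Subgroup G), p.Prime ∧ A.Normal ∧ B.Normal ∧ A.index = p ∧ B.index = p ∧
      A ≠ B := by
  obtain ⟨p, hp, P, hP⟩ : ∃ (p : ℕ) (_ : p.Prime) (P : Sylow p G), ¬ IsCyclic P := by
    by_contra! h
    have : IsZGroup G := ⟨fun p hp P => h p hp P⟩
    exact hc inferInstance
  have := Fact.mk hp
  have hpn : p ∈ (Nat.card G).primeFactors := by
    refine Nat.mem_primeFactors.2 ⟨hp, ?_, Nat.card_pos.ne'⟩
    by_contra hd
    have h1 : Nat.card P = 1 := by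
      rw [P.card_eq_multiplicity, Nat.factorization_eq_zero_of_not_dvd hd, pow_zero]
    have := (Nat.card_eq_one_iff_unique.1 h1).1
    exact hP inferInstance
  let e := Sylow.directProductOfNormal (G := G) fun {q} _ Q => inferInstance
  let f : G →* P := ((Pi.evalMonoidHom (fun Q : Sylow p G => (Q : Subgroup G)) P).comp
    (Pi.evalMonoidHom (fun q : (Nat.card G).primeFactors => ∀ Q : Sylow q G, (Q : Subgroup G))
      ⟨p, hpn⟩)).comp e.symm.toMonoidHom
  have hf : Function.Surjective f := by
    intro x
    classical
    obtain ⟨y, hy⟩ := e.symm.surjective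
      (Pi.mulSingle (M := fun q : (Nat.card G).primeFactors =>
        ∀ Q : Sylow q G, (Q : Subgroup G)) ⟨p, hpn⟩
        (Pi.mulSingle (M := fun Q : Sylow p G => (Q : Subgroup G)) P x))
    refine ⟨y, ?_⟩
    change e.symm y ⟨p, hpn⟩ P = x
    rw [hy]
    simp
  obtain ⟨A, B, hA, hB, hAB⟩ := exists_isCoatom_ne_of_not_isCyclic hP
  have hidx : ∀ M : Subgroup P, IsCoatom M → M.Normal ∧ M.index = p := fun M hM => by
    have hn : M.Normal :=
      Subgroup.NormalizerCondition.normal_of_coatom M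
        (@Group.normalizerCondition_of_isNilpotent _ _ P.isPGroup'.isNilpotent) hM
    have hprime := hM.index_prime_of_normal
    obtain ⟨k, hk⟩ := P.isPGroup'.exists_card_eq
    exact ⟨hn, (Nat.prime_dvd_prime_iff_eq hprime hp).1
      (hprime.dvd_of_dvd_pow (hk ▸ M.index_dvd_card))⟩
  have := (hidx A hA).1
  have := (hidx B hB).1
  refine ⟨p, A.comap f, B.comap f, hp, inferInstance, inferInstance, ?_, ?_,
    fun h => hAB (Subgroup.comap_injective hf h)⟩
  · rw [Subgroup.index_comap_of_surjective _ hf, (hidx A hA).2]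
  · rw [Subgroup.index_comap_of_surjective _ hf, (hidx B hB).2]

theorem Subgroup.index_inf_of_normal_of_index_eq_prime {G : Type*} [Group G] [Finite G] {p : ℕ}
    (hp : p.Prime) (A B : Subgroup G) [A.Normal] (hA : A.index = p) (hB : B.index = p)
    (hAB : A ≠ B) : (A ⊓ B).index = p * p := by
  have h1 : A.relIndex B = p := by
    refine ((Nat.dvd_prime hp).1 (hA ▸ A.relIndex_dvd_index_of_normal B)).resolve_left fun h => ?_
    have hle := Subgroup.relIndex_eq_one.1 h
    refine hAB (Subgroup.eq_of_le_of_card_ge hle ?_).symm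
    refine Nat.le_of_mul_le_mul_left (c := p) (le_of_eq ?_) hp.pos
    conv_lhs => rw [← hA, A.index_mul_card, ← B.index_mul_card, hB]
  rw [← Subgroup.relIndex_mul_index (inf_le_right : A ⊓ B ≤ B), Subgroup.inf_relIndex_right, h1,
    hB]

/-- Two normal subgroups of the same prime index `p` give rise to `p + 1` subgroups of
index `p`. -/
theorem add_one_le_numSubgroups {G : Type*} [Group G] [Finite G] {p m : ℕ}
    (hp : p.Prime) (hG : Nat.card G = p * m) (A B : Subgroup G) [A.Normal] [B.Normal]
    (hA : A.index = p) (hB : B.index = p) (hAB : A ≠ B) : p + 1 ≤ numSubgroups G m := by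
  have hcard : Nat.card (G ⧸ A ⊓ B) = p * p :=
    Subgroup.index_inf_of_normal_of_index_eq_prime hp A B hA hB hAB
  have hpow : ∀ q : G ⧸ A ⊓ B, q ^ p = 1 := fun q => by
    induction q using QuotientGroup.induction_on with
    | H g =>
      rw [← QuotientGroup.mk_pow, QuotientGroup.eq_one_iff]
      exact ⟨hA ▸ A.pow_index_mem g, hB ▸ B.pow_index_mem g⟩
  have hord : Nat.card {q : G ⧸ A ⊓ B // orderOf q = p} = p * p - 1 := by
    have h1 : ∀ q : G ⧸ A ⊓ B, orderOf q = p ↔ q ≠ 1 := fun q => by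
      refine ⟨?_, fun h => ?_⟩
      · rintro h rfl
        exact hp.one_lt.ne (orderOf_one.symm.trans h)
      · have := Fact.mk hp
        exact orderOf_eq_prime_iff.2 ⟨hpow q, h⟩
    have := Fintype.ofFinite (G ⧸ A ⊓ B)
    classical
    rw [Nat.card_congr (Equiv.subtypeEquivRight h1), Nat.card_eq_fintype_card,
      Fintype.card_subtype_compl, Fintype.card_subtype_eq, ← Nat.card_eq_fintype_card, hcard]
  have hnum : numSubgroups (G ⧸ A ⊓ B) p = p + 1 := by
    have h := numSubgroups_prime_mul (G ⧸ A ⊓ B) hp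
    rw [hord] at h
    have h2 : p * p - 1 = (p + 1) * (p - 1) := by
      obtain ⟨k, rfl⟩ : ∃ k, p = k + 1 := ⟨p - 1, by have := hp.pos; omega⟩
      simp only [Nat.add_sub_cancel]
      have : (k + 1) * (k + 1) = (k + 1 + 1) * k + 1 := by ring
      omega
    rw [h2] at h
    exact Nat.eq_of_mul_eq_mul_right (by have := hp.two_le; omega) h
  rw [← hnum]
  have hf := QuotientGroup.mk'_surjective (A ⊓ B)
  refine Nat.card_le_card_of_injective
    (fun K => ⟨K.1.comap (QuotientGroup.mk' (A ⊓ B)), ?_⟩) fun K L h => ?_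
  · have h1 := K.1.index_mul_card
    rw [K.2, hcard] at h1
    have h2 := (K.1.comap (QuotientGroup.mk' (A ⊓ B))).index_mul_card
    rw [Subgroup.index_comap_of_surjective _ hf, Nat.eq_of_mul_eq_mul_right hp.pos h1, hG] at h2
    exact Nat.eq_of_mul_eq_mul_left hp.pos h2
  · exact Subtype.ext (Subgroup.comap_injective hf (Subtype.ext_iff.1 h))

theorem one_le_numSubgroups_prime_pow {G : Type*} [Group G] [Finite G] {p k : ℕ} (hp : p.Prime)
    (h : p ^ k ∣ Nat.card G) : 1 ≤ numSubgroups G (p ^ k) := by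
  have := Fact.mk hp
  obtain ⟨K, hK⟩ := Sylow.exists_subgroup_card_pow_prime p h
  exact hK ▸ numSubgroups_pos K

theorem card_eq_eight_of_subgroupOrderSum {G : Type*} [Group G] [Finite G]
    (hS : subgroupOrderSum G = 2 * Nat.card G + 11) {p : ℕ} (hp : p.Prime)
    (A B : Subgroup G) [A.Normal] [B.Normal] (hA : A.index = p) (hB : B.index = p)
    (hAB : A ≠ B) : Nat.card G = 8 ∧ 3 ≤ numSubgroups G 4 := by
  obtain ⟨k, hk⟩ : p * p ∣ Nat.card G :=
    Subgroup.index_inf_of_normal_of_index_eq_prime hp A B hA hB hAB ▸ (A ⊓ B).index_dvd_card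
  have hk0 : 0 < k := Nat.pos_of_ne_zero fun h => by
    rw [h, mul_zero] at hk; exact Nat.card_pos.ne' hk
  have hm : p + 1 ≤ numSubgroups G (p * k) :=
    add_one_le_numSubgroups hp (hk.trans (mul_assoc _ _ _)) A B hA hB hAB
  have hp1 : 1 ≤ numSubgroups G p := by
    have := one_le_numSubgroups_prime_pow (G := G) (k := 1) hp
      (by rw [hk, pow_one, mul_assoc]; exact Dvd.intro _ rfl)
    rwa [pow_one] at this
  have hn := numSubgroups_card G
  have h1 := numSubgroups_one G
  have hp2 := hp.two_le
  rcases Nat.lt_or_ge k 2 with hk1 | hk2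
  · obtain rfl : k = 1 := by omega
    rw [mul_one] at hk hm
    have hdiv : (Nat.card G).divisors = {1, p, p * p} := by
      rw [hk, ← sq, Nat.divisors_prime_pow hp]
      simp [Finset.map_eq_image, Finset.range_add_one, Finset.image_insert, Finset.ext_iff]
      tauto
    have hup : numSubgroups G p ≤ p + 1 := by
      have h := numSubgroups_prime_mul G hp
      have hlt : Nat.card {x : G // orderOf x = p} < p * p := by
        rw [← hk]
        exact Finite.card_subtype_lt (x := 1) (by rw [orderOf_one]; exact hp.one_lt.ne)
      rw [← h] at hlt
      by_contra! hcon
      obtain ⟨t, rfl⟩ : ∃ t, p = t + 2 := ⟨p - 2, by omega⟩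
      have : (t + 2 + 2) * (t + 1) ≤ numSubgroups G (t + 2) * (t + 2 - 1) :=
        Nat.mul_le_mul hcon (by omega)
      nlinarith
    have hnp : numSubgroups G p = p + 1 := le_antisymm hup hm
    rw [subgroupOrderSum_eq_sum_divisors, hdiv, Finset.sum_insert
      (by simp [hp.one_lt.ne, hp.ne_one, eq_comm]),
      Finset.sum_pair (by simp [hp.ne_zero, hp.ne_one]), h1, hnp, ← hk, hn, hk] at hS
    have : p = 10 := by rw [mul_add] at hS; omega
    rw [this] at hp
    norm_num at hp
  have hpk : p < p * k := by nlinarith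
  have hpkn : p * k < Nat.card G := by rw [hk]; nlinarith
  have hmm : Nat.card G + p * k ≤ p * k * numSubgroups G (p * k) := by
    rw [hk]; nlinarith [Nat.mul_le_mul_left (p * k) hm]
  have hle := sum_mul_numSubgroups_le G {1, p, p * k, Nat.card G} (by
    simp only [Finset.mem_insert, Finset.mem_singleton]
    rintro d (rfl | rfl | rfl | rfl)
    · exact one_dvd _
    · exact ⟨d * k, by rw [hk, mul_assoc]⟩
    · exact ⟨p, by rw [hk]; ring⟩
    · exact dvd_rfl)
  rw [Finset.sum_insert (by simp only [Finset.mem_insert, Finset.mem_singleton]; omega),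
    Finset.sum_insert (by simp only [Finset.mem_insert, Finset.mem_singleton]; omega),
    Finset.sum_pair (by omega), h1, hn, hS] at hle
  have hpp : p ≤ p * numSubgroups G p := by nlinarith
  have hb : p + p * k ≤ 10 := by omega
  have hp3 : p ≤ 3 := by nlinarith
  have hk4 : k ≤ 4 := by nlinarith
  have two := fun j => one_le_numSubgroups_prime_pow (G := G) (k := j) Nat.prime_two
  have three := one_le_numSubgroups_prime_pow (G := G) (k := 1) Nat.prime_three
  clear hle hmm hpp hpkn hpk hA hB
  interval_cases p <;> interval_cases k <;> first
    | (exfalso; omega)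
    | norm_num at hk hm hS
  · exact ⟨hk, hm⟩
  · have t1 := two 1 (by rw [hk]; norm_num)
    have t2 := three (by rw [hk]; norm_num)
    have := sum_mul_numSubgroups_le G {1, 2, 3, 6, 12} (by rw [hk]; decide)
    rw [hk] at hn
    simp at this t1 t2
    omega
  · have t1 := two 1 (by rw [hk]; norm_num)
    have t2 := two 2 (by rw [hk]; norm_num)
    have := sum_mul_numSubgroups_le G {1, 2, 4, 8, 16} (by rw [hk]; decide)
    rw [hk] at hn
    simp at this t1 t2
    omega
  · have t1 := two 1 (by rw [hk]; norm_num)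
    have t2 := three (by rw [hk]; norm_num)
    have := sum_mul_numSubgroups_le G {1, 2, 3, 6, 18} (by rw [hk]; decide)
    rw [hk] at hn
    simp at this t1 t2
    omega

/-- A group of order `8` generated by two elements has at most three subgroups of order `4`. -/
theorem numSubgroups_four_le_three {G : Type*} [Group G] [Finite G] (hG : Nat.card G = 8)
    {x y : G} (hxy : Subgroup.closure {x, y} = ⊤) : numSubgroups G 4 ≤ 3 := by
  classical
  have hidx : ∀ K : Subgroup G, Nat.card K = 4 → K.index = 2 := fun K hK => by
    have := K.index_mul_card
    rw [hK, hG] at this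
    omega
  have hgen : ∀ K : Subgroup G, x ∈ K → y ∈ K → K = ⊤ := fun K hx hy => by
    rw [eq_top_iff, ← hxy, Subgroup.closure_le]
    rintro _ (rfl | rfl) <;> assumption
  have h3 : Nat.card {q : Bool × Bool // q ≠ (true, true)} = 3 := by
    rw [Nat.card_eq_fintype_card]; decide
  rw [← h3]
  refine Nat.card_le_card_of_injective (fun K => ⟨(decide (x ∈ K.1), decide (y ∈ K.1)), ?_⟩) ?_
  · intro h
    simp only [Prod.mk.injEq, decide_eq_true_eq] at h
    have := hgen K.1 h.1 h.2
    have h4 := K.2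
    rw [this, Subgroup.card_top, hG] at h4
    omega
  · rintro ⟨K, hK⟩ ⟨L, hL⟩ h
    simp only [Subtype.mk.injEq, Prod.mk.injEq, decide_eq_decide] at h
    let E : Subgroup G :=
      { carrier := {g | g ∈ K ↔ g ∈ L}
        one_mem' := by simp [one_mem]
        mul_mem' := fun {a b} ha hb => by
          simp only [Set.mem_ofPred_eq] at ha hb ⊢
          rw [Subgroup.mul_mem_iff_of_index_two (hidx K hK),
            Subgroup.mul_mem_iff_of_index_two (hidx L hL), ha, hb]
        inv_mem' := fun {a} ha => by simpa using ha }
    have hE := hgen E h.1 h.2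
    refine Subtype.ext (Subgroup.ext fun g => ?_)
    have : g ∈ E := hE ▸ Subgroup.mem_top g
    exact this

theorem closure_pair_eq_top_of_card_eq_eight {G : Type*} [Group G] [Finite G]
    (hG : Nat.card G = 8) {x y : G} (hx : orderOf x = 4) (hy : y ∉ Subgroup.zpowers x) :
    Subgroup.closure {x, y} = ⊤ := by
  have hle : Subgroup.zpowers x ≤ Subgroup.closure {x, y} := by
    rw [Subgroup.zpowers_le]; exact Subgroup.subset_closure (by simp)
  have h4 : Nat.card (Subgroup.zpowers x) = 4 := (Nat.card_zpowers x).trans hx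
  rw [← Subgroup.card_eq_iff_eq_top, hG]
  have h1 := Subgroup.card_dvd_of_le hle
  have h2 := (Subgroup.closure {x, y}).card_subgroup_dvd_card
  rw [hG] at h2
  rw [h4] at h1
  have h3 : Nat.card (Subgroup.closure {x, y}) ≠ 4 := fun h => hy <| by
    rw [Subgroup.eq_of_le_of_card_ge hle (by omega)]
    exact Subgroup.subset_closure (by simp)
  have := Nat.le_of_dvd (by norm_num) h2
  generalize Nat.card (Subgroup.closure {x, y}) = c at *
  interval_cases c <;> omega

theorem exists_eq_pow_of_mem_zpowers_of_orderOf_eq_four {G : Type*} [Group G] {x w : G}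
    (hx : orderOf x = 4) (hw : w ∈ Subgroup.zpowers x) :
    w = 1 ∨ w = x ∨ w = x ^ 2 ∨ w = x ^ 3 := by
  classical
  have : IsOfFinOrder x := orderOf_pos_iff.1 (by omega)
  rw [this.mem_zpowers_iff_mem_range_orderOf, hx] at hw
  simp [Finset.range_add_one] at hw
  tauto

theorem nonempty_mulEquiv_of_commute {G : Type*} [Group G] [Finite G] (hG : Nat.card G = 8)
    {x z : G} (hx : orderOf x = 4) (hz : orderOf z = 2) (hzx : z ∉ Subgroup.zpowers x)
    (hc : Commute z x) : Nonempty (G ≃* Multiplicative (ZMod 2 × ZMod 4)) := by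
  let f : Subgroup.zpowers z × Subgroup.zpowers x →* G :=
    (Subgroup.zpowers z).subtype.noncommCoprod (Subgroup.zpowers x).subtype (by
      rintro ⟨_, i, rfl⟩ ⟨_, j, rfl⟩
      exact hc.zpow_zpow i j)
  have hf : Function.Surjective f := by
    rw [← MonoidHom.range_eq_top, eq_top_iff, ← closure_pair_eq_top_of_card_eq_eight hG hx hzx,
      Subgroup.closure_le]
    rintro _ (rfl | rfl)
    · exact ⟨(1, ⟨_, Subgroup.mem_zpowers _⟩), by simp [f]⟩
    · exact ⟨(⟨_, Subgroup.mem_zpowers _⟩, 1), by simp [f]⟩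
  have hZ : Nat.card (Subgroup.zpowers z) = 2 := (Nat.card_zpowers z).trans hz
  have hX : Nat.card (Subgroup.zpowers x) = 4 := (Nat.card_zpowers x).trans hx
  have hb : Function.Bijective f := (Nat.bijective_iff_surjective_and_card f).2
    ⟨hf, by rw [Nat.card_prod, hZ, hX, hG]⟩
  have e2 : Subgroup.zpowers z ≃* Multiplicative (ZMod 2) :=
    mulEquivOfCyclicCardEq (by rw [hZ]; simp)
  have e4 : Subgroup.zpowers x ≃* Multiplicative (ZMod 4) :=
    mulEquivOfCyclicCardEq (by rw [hX]; simp)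
  exact ⟨((MulEquiv.ofBijective f hb).symm.trans (e2.prodCongr e4)).trans
    (MulEquiv.prodMultiplicative _ _).symm⟩

theorem Nat.divisors_eight : Nat.divisors 8 = {1, 2, 4, 8} := by decide

theorem subgroupOrderSum_of_card_eq_eight {G : Type*} [Group G] [Finite G]
    (hG : Nat.card G = 8) :
    subgroupOrderSum G = 9 + 2 * numSubgroups G 2 + 4 * numSubgroups G 4 := by
  have := numSubgroups_card G
  rw [hG] at this
  rw [subgroupOrderSum_eq_sum_divisors, hG, Nat.divisors_eight]
  simp [numSubgroups_one, this]
  ring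

theorem exists_orderOf_eq_four {G : Type*} [Group G] [Finite G] (hc : ¬ IsCyclic G)
    (hG : Nat.card G = 8) (h2 : numSubgroups G 2 ≠ 7) : ∃ x : G, orderOf x = 4 := by
  by_contra! h
  refine h2 ?_
  have key := numSubgroups_prime_mul G Nat.prime_two
  have h1 : ∀ x : G, orderOf x = 2 ↔ x ≠ 1 := fun x => by
    refine ⟨?_, fun h1 => ?_⟩
    · rintro hx rfl
      simp at hx
    · have hd : orderOf x ∣ 8 := hG ▸ orderOf_dvd_natCard x
      have h8 : orderOf x ≠ 8 := fun h8 => hc (isCyclic_of_orderOf_eq_card x (h8.trans hG.symm))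
      have h4 := h x
      have h1' : orderOf x ≠ 1 := by simpa using h1
      have : orderOf x ∈ Nat.divisors 8 := Nat.mem_divisors.2 ⟨hd, by norm_num⟩
      rw [Nat.divisors_eight] at this
      simp only [Finset.mem_insert, Finset.mem_singleton] at this
      tauto
  have := Fintype.ofFinite G
  classical
  rw [Nat.card_congr (Equiv.subtypeEquivRight h1), Nat.card_eq_fintype_card,
    Fintype.card_subtype_compl, Fintype.card_subtype_eq, ← Nat.card_eq_fintype_card, hG] at key
  omega

theorem nonempty_mulEquiv_of_card_eq_eight {G : Type*} [Group G] [Finite G]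
    (hc : ¬ IsCyclic G) (hG : Nat.card G = 8) (hS : subgroupOrderSum G = 27)
    (h4 : 3 ≤ numSubgroups G 4) : Nonempty (G ≃* Multiplicative (ZMod 2 × ZMod 4)) := by
  rw [subgroupOrderSum_of_card_eq_eight hG] at hS
  obtain ⟨x, hx⟩ := exists_orderOf_eq_four hc hG (by omega)
  have hX : Nat.card (Subgroup.zpowers x) = 4 := (Nat.card_zpowers x).trans hx
  obtain ⟨y, hy⟩ : ∃ y, y ∉ Subgroup.zpowers x := by
    by_contra! h
    have := (Subgroup.card_eq_iff_eq_top _).2 (eq_top_iff.2 fun g _ => h g)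
    omega
  have hle := numSubgroups_four_le_three hG (closure_pair_eq_top_of_card_eq_eight hG hx hy)
  have hinv : Nat.card {w : G // orderOf w = 2} = 3 := by
    rw [← numSubgroups_prime_mul G Nat.prime_two]; omega
  have hpow : ∀ i, x ^ i = 1 ↔ 4 ∣ i := fun i => by rw [← hx, orderOf_dvd_iff_pow_eq_one]
  have hp1 : x ≠ 1 := fun h => by simp [h] at hx
  obtain ⟨z, hz, hzx⟩ : ∃ z, orderOf z = 2 ∧ z ∉ Subgroup.zpowers x := by
    by_contra! h
    have huniq : ∀ w : G, orderOf w = 2 → w = x ^ 2 := fun w hw => by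
      have hw2 : w ^ 2 = 1 := hw ▸ pow_orderOf_eq_one w
      rcases exists_eq_pow_of_mem_zpowers_of_orderOf_eq_four hx (h w hw) with rfl | rfl | h | rfl
      · simp at hw
      · omega
      · exact h
      · rw [← pow_mul, hpow] at hw2
        omega
    have : Subsingleton {w : G // orderOf w = 2} :=
      ⟨fun a b => Subtype.ext ((huniq _ a.2).trans (huniq _ b.2).symm)⟩
    have := Finite.card_le_one_iff_subsingleton.2 this
    omega
  have hz2 : z * z = 1 := by rw [← sq, ← hz, pow_orderOf_eq_one]
  have hzi : z⁻¹ = z := inv_eq_of_mul_eq_one_left hz2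
  have hXn : (Subgroup.zpowers x).Normal := Subgroup.normal_of_index_eq_two (by
    have := (Subgroup.zpowers x).index_mul_card
    rw [hX, hG] at this
    omega)
  refine nonempty_mulEquiv_of_commute hG hx hz hzx ?_
  have hconj := hXn.conj_mem x (Subgroup.mem_zpowers x) z
  rcases exists_eq_pow_of_mem_zpowers_of_orderOf_eq_four hx hconj with h | h | h | h
  · exact absurd (conj_eq_one_iff.1 h) hp1
  · exact mul_inv_eq_iff_eq_mul.1 h
  · have h2 : (z * x * z⁻¹) ^ 2 = 1 := by rw [h, ← pow_mul, hpow]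
    rw [conj_pow, conj_eq_one_iff, hpow] at h2
    omega
  · exfalso
    have h3 : z * x * z⁻¹ = x⁻¹ := by
      rw [h]; exact eq_inv_of_mul_eq_one_left (by rw [← pow_succ, hpow])
    have hord : ∀ i : ℕ, orderOf (z * x ^ i) = 2 := fun i => by
      rw [orderOf_eq_prime_iff]
      refine ⟨?_, fun h1 => hzx ?_⟩
      · have : z * x ^ i * z⁻¹ = (x ^ i)⁻¹ := by rw [← conj_pow, h3, inv_pow]
        rw [sq, ← mul_assoc]
        nth_rewrite 2 [← hzi]
        rw [this, inv_mul_cancel]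
      · rw [eq_inv_of_mul_eq_one_left h1]
        exact inv_mem (pow_mem (Subgroup.mem_zpowers x) i)
    have := Nat.card_le_card_of_injective
      (fun i : Fin 4 => (⟨z * x ^ (i : ℕ), hord i⟩ : {w : G // orderOf w = 2})) (by
        intro i j hij
        have := mul_left_cancel (Subtype.ext_iff.1 hij)
        exact Fin.ext (pow_injOn_Iio_orderOf (by simp [hx]) (by simp [hx]) this))
    rw [hinv, Nat.card_fin] at this
    omega

theorem nonempty_mulEquiv_of_isNilpotent {G : Type*} [Group G] [Finite G]
    (hc : ¬ IsCyclic G) (hG : Group.IsNilpotent G)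
    (hS : subgroupOrderSum G = 2 * Nat.card G + 11) :
    Nonempty (G ≃* Multiplicative (ZMod 2 × ZMod 4)) := by
  obtain ⟨p, A, B, hp, _, _, hA, hB, hAB⟩ := exists_normal_index_eq_prime_ne hc hG
  obtain ⟨h8, h4⟩ := card_eq_eight_of_subgroupOrderSum hS hp A B hA hB hAB
  exact nonempty_mulEquiv_of_card_eq_eight hc h8 (by rw [hS, h8]) h4

theorem orderOf_eq_prime_iff_pow_eq_one {G : Type*} [Group G] {p : ℕ} (hp : p.Prime) (x : G) :
    orderOf x = p ↔ x ^ p = 1 ∧ x ≠ 1 :=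
  have := Fact.mk hp
  orderOf_eq_prime_iff

theorem not_isCyclic_multiplicative_zmod_two_prod_zmod_four :
    ¬ IsCyclic (Multiplicative (ZMod 2 × ZMod 4)) := fun h => by
  have h1 := IsCyclic.exponent_eq_card (α := Multiplicative (ZMod 2 × ZMod 4))
  have h2 : Monoid.exponent (Multiplicative (ZMod 2 × ZMod 4)) ∣ 4 :=
    Monoid.exponent_dvd_of_forall_pow_eq_one (by decide)
  rw [h1] at h2
  simp at h2

theorem card_multiplicative_zmod_two_prod_zmod_four :
    Nat.card (Multiplicative (ZMod 2 × ZMod 4)) = 8 := by simp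

theorem subgroupOrderSum_multiplicative_zmod_two_prod_zmod_four :
    subgroupOrderSum (Multiplicative (ZMod 2 × ZMod 4)) = 27 := by
  have hcard := card_multiplicative_zmod_two_prod_zmod_four
  have h2 : numSubgroups (Multiplicative (ZMod 2 × ZMod 4)) 2 = 3 := by
    have h := numSubgroups_prime_mul (Multiplicative (ZMod 2 × ZMod 4)) Nat.prime_two
    rw [Nat.card_congr (Equiv.subtypeEquivRight
      (orderOf_eq_prime_iff_pow_eq_one Nat.prime_two)), Nat.card_eq_fintype_card] at h
    have h3 : Fintype.card {x : Multiplicative (ZMod 2 × ZMod 4) // x ^ 2 = 1 ∧ x ≠ 1} = 3 := by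
      decide
    omega
  have h4 : numSubgroups (Multiplicative (ZMod 2 × ZMod 4)) 4 = 3 := by
    refine le_antisymm ?_ ?_
    · obtain ⟨x, hx⟩ := exists_orderOf_eq_four
        not_isCyclic_multiplicative_zmod_two_prod_zmod_four hcard (by omega)
      have hX := (Nat.card_zpowers x).trans hx
      obtain ⟨y, hy⟩ : ∃ y, y ∉ Subgroup.zpowers x := by
        by_contra! h
        have := (Subgroup.card_eq_iff_eq_top _).2 (eq_top_iff.2 fun g _ => h g)
        omega
      exact numSubgroups_four_le_three hcard (closure_pair_eq_top_of_card_eq_eight hcard hx hy)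
    · obtain ⟨p, A, B, hp, _, _, hA, hB, hAB⟩ := exists_normal_index_eq_prime_ne
        not_isCyclic_multiplicative_zmod_two_prod_zmod_four inferInstance
      have hd : p ∣ 2 ^ 3 := by
        have := A.index_dvd_card
        rwa [hA, hcard] at this
      obtain rfl := (Nat.prime_dvd_prime_iff_eq hp Nat.prime_two).1 (hp.dvd_of_dvd_pow hd)
      exact add_one_le_numSubgroups (m := 4) hp hcard A B hA hB hAB
  rw [subgroupOrderSum_of_card_eq_eight hcard, h2, h4]

theorem card_alternatingGroup_fin_four : Nat.card (alternatingGroup (Fin 4)) = 12 :=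
  alternatingGroup.card_of_card_eq_four (by simp)

theorem not_isNilpotent_alternatingGroup_fin_four :
    ¬ Group.IsNilpotent (alternatingGroup (Fin 4)) := fun h => by
  have : Nontrivial (alternatingGroup (Fin 4)) :=
    Finite.one_lt_card_iff_nontrivial.1 (by rw [card_alternatingGroup_fin_four]; norm_num)
  exact Group.IsNilpotent.center_ne_bot _
    (alternatingGroup.center_eq_bot (α := Fin 4) (by simp))

theorem Nat.divisors_twelve : Nat.divisors 12 = {1, 2, 3, 4, 6, 12} := by decide

theorem subgroupOrderSum_alternatingGroup_fin_four :
    subgroupOrderSum (alternatingGroup (Fin 4)) = 35 := by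
  have hcard := card_alternatingGroup_fin_four
  have ho3 : Nat.card {x : alternatingGroup (Fin 4) // orderOf x = 3} = 8 := by
    rw [Nat.card_congr (Equiv.subtypeEquivRight
      (orderOf_eq_prime_iff_pow_eq_one Nat.prime_three)), Nat.card_eq_fintype_card]
    decide
  have h3 : numSubgroups (alternatingGroup (Fin 4)) 3 = 4 := by
    have h := numSubgroups_prime_mul (alternatingGroup (Fin 4)) Nat.prime_three
    omega
  have h2 : numSubgroups (alternatingGroup (Fin 4)) 2 = 3 := by
    have h := numSubgroups_prime_mul (alternatingGroup (Fin 4)) Nat.prime_two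
    rw [Nat.card_congr (Equiv.subtypeEquivRight
      (orderOf_eq_prime_iff_pow_eq_one Nat.prime_two)), Nat.card_eq_fintype_card] at h
    have h3 : Fintype.card {x : alternatingGroup (Fin 4) // x ^ 2 = 1 ∧ x ≠ 1} = 3 := by
      decide
    omega
  have h4 : numSubgroups (alternatingGroup (Fin 4)) 4 = 1 := by
    have := alternatingGroup.subsingleton_two_sylow (α := Fin 4) (by simp)
    have h := numSubgroups_eq_card_sylow (G := alternatingGroup (Fin 4)) (p := 2)
    have hf : (Nat.card (alternatingGroup (Fin 4))).factorization 2 = 2 := by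
      rw [hcard, show 12 = 2 ^ 2 * 3 by norm_num, Nat.factorization_mul (by norm_num) (by norm_num),
        Nat.prime_two.factorization_pow, Nat.prime_three.factorization]
      simp
    rw [hf] at h
    exact h.trans Nat.card_unique
  have h6 : numSubgroups (alternatingGroup (Fin 4)) 6 = 0 := by
    refine Nat.card_eq_zero.2 (Or.inl ⟨?_⟩)
    rintro ⟨K, hK⟩
    have hidx : K.index = 2 := by
      have := K.index_mul_card
      rw [hK, hcard] at this
      omega
    have hle := Nat.card_le_card_of_injective
      (fun x : {x : alternatingGroup (Fin 4) // orderOf x = 3} => (⟨x.1, by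
        have h1 := Subgroup.sq_mem_of_index_two hidx (x.1 ^ 2)
        have h2 : x.1 ^ 3 = 1 := by
          have := pow_orderOf_eq_one x.1
          rwa [x.2] at this
        rwa [← pow_mul, pow_succ, h2, one_mul] at h1⟩ : K)) fun a b h =>
          Subtype.ext (congrArg (fun k : K => (k : alternatingGroup (Fin 4))) h)
    omega
  have hn := numSubgroups_card (alternatingGroup (Fin 4))
  rw [hcard] at hn
  rw [subgroupOrderSum_eq_sum_divisors, hcard, Nat.divisors_twelve]
  simp [numSubgroups_one, h2, h3, h4, h6, hn]

theorem corollary2p5 :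
    (∀ (G : Type*) [Group G] [Finite G],
      (¬ IsCyclic G ∧ Group.IsNilpotent G ∧ sigmaOne G = 2 + 11 / (Nat.card G : ℚ)) ↔
        Nonempty (G ≃* Multiplicative (ZMod 2 × ZMod 4))) ∧
    (∀ (G : Type*) [Group G] [Finite G],
      (¬ Group.IsNilpotent G ∧ sigmaOne G = 2 + 11 / (Nat.card G : ℚ)) ↔
        Nonempty (G ≃* alternatingGroup (Fin 4))) := by
  refine ⟨fun G _ _ => ⟨fun ⟨hc, hn, hS⟩ => ?_, fun ⟨e⟩ => ⟨fun hc => ?_, ?_, ?_⟩⟩,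
    fun G _ _ => ⟨fun ⟨hn, hS⟩ => ?_, fun ⟨e⟩ => ⟨fun hn => ?_, ?_⟩⟩⟩
  · exact nonempty_mulEquiv_of_isNilpotent hc hn ((sigmaOne_eq_iff G).1 hS)
  · exact not_isCyclic_multiplicative_zmod_two_prod_zmod_four (e.isCyclic.1 hc)
  · exact Group.nilpotent_of_mulEquiv e.symm
  · rw [sigmaOne_eq_iff, subgroupOrderSum_congr e, Nat.card_congr e.toEquiv,
      subgroupOrderSum_multiplicative_zmod_two_prod_zmod_four,
      card_multiplicative_zmod_two_prod_zmod_four]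
  · exact nonempty_mulEquiv_alternatingGroup_of_subgroupOrderSum hn ((sigmaOne_eq_iff G).1 hS)
  · exact not_isNilpotent_alternatingGroup_fin_four (Group.nilpotent_of_mulEquiv e)
  · rw [sigmaOne_eq_iff, subgroupOrderSum_congr e, Nat.card_congr e.toEquiv,
      subgroupOrderSum_alternatingGroup_fin_four, card_alternatingGroup_fin_four]
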